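/- Let $\mathcal H$ be a finite-dimensional complex Hilbert space, $\mathcal H_S\subseteq\mathcal H$ a subspace with orthogonal projection $\Pi_0$, and $\mathcal S(\mathcal H)$ the set of density operators (positive semidefinite operators of trace one). Let $n,m\in\mathbb N$, and let $H(x)=H(x)^*$ and $L_1(x),\dots,L_m(x)$ be operators on $\mathcal H$ that depend polynomially on the real parameters $x\in\mathbb R^n$ (that is, each of them is a finite sum $\sum_\alpha x^\alpha A_\alpha$ with operator coefficients $A_\alpha$). For each $x$ consider the Lindblad equation on $t\ge 0$ $$\dot\rho_t=-i[H(x),\rho_t]+\sum_{k=1}^m\Big(L_k(x)\rho_tL_k(x)^*-\tfrac12L_k(x)^*L_k(x)\rho_t-\tfrac12\rho_tL_k(x)^*L_k(x)\Big),\qquad \rho_0\in\mathcal S(\mathcal H).\tag{1}$$ Put $\mathbf d_0(\rho)=\|\rho-\Pi_0\rho\Pi_0\|$. Call $\mathcal H_S$ invariant for (1) if $\rho_0\in\mathcal S(\mathcal H)$ and $\operatorname{Tr}(\Pi_0\rho_0)=1$ imply $\rho_t\in\mathcal S(\mathcal H)$ and $\operatorname{Tr}(\Pi_0\rho_t)=1$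 for all $t\ge0$. Call $\mathcal H_S$ globally asymptotically stable (GAS) for (1) if it is invariant, if for every $\varepsilon\in(0,1)$ there is $\delta>0$ such that $\mathbf d_0(\rho_0)<\delta$ implies $\mathbf d_0(\rho_t)\le\varepsilon$ for all $t\ge0$, and if $\lim_{t\to\infty}\mathbf d_0(\rho_t)=0$ for every $\rho_0\in\mathcal S(\mathcal H)$. Suppose that $\mathcal H_S$ is invariant for (1) for every $x\in\mathbb R^n$. If there is $\bar x\in\mathbb R^n$ such that $\mathcal H_S$ is GAS for (1) with $x=\bar x$, then $\mathcal H_S$ is GAS for (1) for Lebesgue-almost every $x\in\mathbb R^n$. -/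

import Mathlib

noncomputable section

namespace QuantumGAS

variable {E : Type*} [NormedAddCommGroup E] [InnerProductSpace ℂ E]
  [FiniteDimensional ℂ E] [CompleteSpace E]

/-- The dissipator `D_L(ρ) = L ρ L* - (1/2) L* L ρ - (1/2) ρ L* L`. -/
def dissipator (L ρ : E →L[ℂ] E) : E →L[ℂ] E :=
  L * ρ * L.adjoint - (1 / 2 : ℂ) • (L.adjoint * L * ρ) - (1 / 2 : ℂ) • (ρ * (L.adjoint * L))

/-- The Lindblad generator `-i [H, ρ] + ∑ₖ D_{Lₖ}(ρ)`. -/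
def lindblad {m : ℕ} (H : E →L[ℂ] E) (L : Fin m → E →L[ℂ] E) (ρ : E →L[ℂ] E) : E →L[ℂ] E :=
  -Complex.I • (H * ρ - ρ * H) + ∑ k, dissipator (L k) ρ

/-- A trajectory on `[0, ∞)` of `ρ' = -i [H, ρ] + ∑ₖ D_{Lₖ}(ρ)`
(the derivative at time `0` being one-sided). -/
def IsTrajectory {m : ℕ} (H : E →L[ℂ] E) (L : Fin m → E →L[ℂ] E) (ρ : ℝ → E →L[ℂ] E) : Prop :=
  ∀ t : ℝ, 0 ≤ t → HasDerivWithinAt ρ (lindblad H L (ρ t)) (Set.Ici 0) t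

variable (E) in
/-- The density operators: self-adjoint, positive semidefinite, of trace one. -/
def densityOperators : Set (E →L[ℂ] E) :=
  {ρ | ρ.IsPositive ∧ LinearMap.trace ℂ E (ρ : E →ₗ[ℂ] E) = 1}

/-- The density operators supported in the subspace `S`, that is, `Tr(Π₀ ρ) = 1`
with `Π₀` the orthogonal projection onto `S`. -/
def supportedIn (S : Submodule ℂ E) : Set (E →L[ℂ] E) :=
  {ρ | ρ ∈ densityOperators E ∧
    LinearMap.trace ℂ E ((S.starProjection * ρ : E →L[ℂ] E) : E →ₗ[ℂ] E) = 1}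

/-- `d₀(ρ) = ‖ρ - Π₀ ρ Π₀‖` (operator norm). -/
def dist₀ (S : Submodule ℂ E) (ρ : E →L[ℂ] E) : ℝ :=
  ‖ρ - S.starProjection * ρ * S.starProjection‖

/-- `S` is invariant: trajectories starting from a state supported in `S` remain so. -/
def IsInvariant {m : ℕ} (S : Submodule ℂ E) (H : E →L[ℂ] E) (L : Fin m → E →L[ℂ] E) : Prop :=
  ∀ ρ : ℝ → E →L[ℂ] E, IsTrajectory H L ρ → ρ 0 ∈ supportedIn S →
    ∀ t : ℝ, 0 ≤ t → ρ t ∈ supportedIn S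

/-- `S` is stable: trajectories of states starting close to `S` remain close to `S`. -/
def IsStable {m : ℕ} (S : Submodule ℂ E) (H : E →L[ℂ] E) (L : Fin m → E →L[ℂ] E) : Prop :=
  ∀ ε : ℝ, 0 < ε → ε < 1 → ∃ δ : ℝ, 0 < δ ∧
    ∀ ρ : ℝ → E →L[ℂ] E, IsTrajectory H L ρ → ρ 0 ∈ densityOperators E →
      dist₀ S (ρ 0) < δ → ∀ t : ℝ, 0 ≤ t → dist₀ S (ρ t) ≤ ε

/-- `S` is globally asymptotically stable: it is invariant, stable, and every trajectory of
states converges to `S`. -/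
def IsGAS {m : ℕ} (S : Submodule ℂ E) (H : E →L[ℂ] E) (L : Fin m → E →L[ℂ] E) : Prop :=
  IsInvariant S H L ∧ IsStable S H L ∧
    ∀ ρ : ℝ → E →L[ℂ] E, IsTrajectory H L ρ → ρ 0 ∈ densityOperators E →
      Filter.Tendsto (fun t => dist₀ S (ρ t)) Filter.atTop (nhds 0)

/-- `A(x) = ∑_α x^α A_α` (a finite sum over multi-indices, with operator coefficients): the
operator `A(x)` depends polynomially on the real parameters `x₁, …, xₙ`. -/
def IsPolynomialFamily {n : ℕ} (A : (Fin n → ℝ) → E →L[ℂ] E) : Prop :=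
  ∃ (s : Finset (Fin n → ℕ)) (a : (Fin n → ℕ) → E →L[ℂ] E),
    ∀ x : Fin n → ℝ, A x = ∑ α ∈ s, ((∏ i, x i ^ α i : ℝ) : ℂ) • a α

end QuantumGAS

end

set_option linter.unusedSectionVars false

noncomputable section

namespace QuantumGAS

open scoped ComplexOrder

variable {E : Type*} [NormedAddCommGroup E] [InnerProductSpace ℂ E]
  [FiniteDimensional ℂ E]

/-! ### Positive operators and the trace -/

/-! Let `Λ` be the generator, `p` the projection onto `S`, `Q ρ = ρ - p ρ p`. Invariance makes `p
B(E) p` stable under `exp (t Λ)`, so `Q Λ = Q Λ Q`. Put `M = Q Λ Q + (1 - Q)`. Given invariance, GAS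
is equivalent to `det M ≠ 0`, and `det M` is real analytic in the parameters; being nonzero at one
point, it is nonzero off a null set.

GAS gives `det M ≠ 0` (`IsGAS.det_compressedGenerator_ne_zero`): if `M ρ = 0` then `Q ρ = ρ` and `Q
exp (t Λ) ρ` is constant, whereas GAS and the fact that states span all operators force it to tend
to zero.

Conversely (`isGAS_of_det_ne_zero`), no spectral theory is needed. Along a trajectory of states the
derivative of `Q ρ_t` is `M Q ρ_t`, so the leakage `Tr ((1 - p) ρ_t) ≥ 0` has the bounded primitive
`Re Tr ((1 - p) M⁻¹ Q ρ_t)`. It is also Lipschitz, hence tends to zero, and `norm_offSupport_sq_le`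
bounds `Q ρ_t` by it. Boundedness of the semigroup then yields stability. Both bounds rest on
preservation of states (`flow_mem_densityOperators`). -/

variable (E) in
/-- The trace as a continuous linear functional on operators. -/
def traceCLM : (E →L[ℂ] E) →L[ℂ] ℂ :=
  LinearMap.toContinuousLinearMap (LinearMap.trace ℂ E ∘ₗ ContinuousLinearMap.coeLM ℂ)

theorem traceCLM_apply (ρ : E →L[ℂ] E) :
    traceCLM E ρ = LinearMap.trace ℂ E (ρ : E →ₗ[ℂ] E) := rfl

theorem traceCLM_mul_comm (ρ σ : E →L[ℂ] E) : traceCLM E (ρ * σ) = traceCLM E (σ * ρ) :=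
  LinearMap.trace_mul_comm ℂ (ρ : E →ₗ[ℂ] E) (σ : E →ₗ[ℂ] E)

theorem traceCLM_nonneg {ρ : E →L[ℂ] E} (hρ : ρ.IsPositive) : 0 ≤ traceCLM E ρ :=
  LinearMap.IsPositive.trace_nonneg hρ

/-- A positive operator is a sum of rank-one terms `u u*`, each with norm equal to its trace. -/
theorem norm_le_re_traceCLM {ρ : E →L[ℂ] E} (hρ : ρ.IsPositive) :
    ‖ρ‖ ≤ (traceCLM E ρ).re := by
  obtain ⟨m, u, rfl⟩ := ContinuousLinearMap.isPositive_iff_eq_sum_rankOne.1 hρ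
  rw [map_sum, Complex.re_sum]
  refine (norm_sum_le _ _).trans (Finset.sum_le_sum fun i _ => ?_)
  rw [traceCLM_apply, InnerProductSpace.trace_rankOne, InnerProductSpace.norm_rankOne,
    ← sq, inner_self_eq_norm_sq_to_K]
  norm_cast

theorem eq_zero_of_traceCLM_eq_zero {ρ : E →L[ℂ] E} (hρ : ρ.IsPositive)
    (h : traceCLM E ρ = 0) : ρ = 0 := by
  have := norm_le_re_traceCLM hρ
  rw [h, Complex.zero_re] at this
  exact norm_le_zero_iff.1 this

variable [CompleteSpace E]

theorem exists_star_mul_self {ρ : E →L[ℂ] E} (hρ : ρ.IsPositive) : ∃ s, ρ = star s * s :=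
  CStarAlgebra.nonneg_iff_eq_star_mul_self.1 ((ContinuousLinearMap.nonneg_iff_isPositive ρ).2 hρ)

/-- Cauchy-Schwarz in C*-form: with `ρ = s* s`, factor `ρ q = s* (s q)` and use `‖s q‖² = ‖q* ρ q‖`.
-/
theorem norm_mul_sq_le {ρ : E →L[ℂ] E} (hρ : ρ.IsPositive) (q : E →L[ℂ] E) :
    ‖ρ * q‖ ^ 2 ≤ ‖ρ‖ * ‖star q * ρ * q‖ := by
  obtain ⟨s, rfl⟩ := exists_star_mul_self hρ
  have h1 : star q * (star s * s) * q = star (s * q) * (s * q) := by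
    simp only [star_mul, mul_assoc]
  rw [h1, CStarRing.norm_star_mul_self, CStarRing.norm_star_mul_self, mul_assoc]
  have h2 : ‖star s * (s * q)‖ ≤ ‖s‖ * ‖s * q‖ := by
    simpa using norm_mul_le (star s) (s * q)
  calc ‖star s * (s * q)‖ ^ 2 ≤ (‖s‖ * ‖s * q‖) ^ 2 := by gcongr
    _ = _ := by ring

theorem isPositive_mul_mul_star {ρ : E →L[ℂ] E} (hρ : ρ.IsPositive) (a : E →L[ℂ] E) :
    (a * ρ * star a).IsPositive := by
  have := hρ.conj_adjoint a
  rwa [← ContinuousLinearMap.mul_def, ← ContinuousLinearMap.mul_def, ← mul_assoc] at this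

/-! ### Compression to the subspace, and the part of an operator outside it -/

theorem star_starProjection (S : Submodule ℂ E) : star S.starProjection = S.starProjection :=
  isSelfAdjoint_starProjection S

theorem starProjection_mul_self (S : Submodule ℂ E) :
    S.starProjection * S.starProjection = S.starProjection :=
  S.isIdempotentElem_starProjection

/-- The projection `ρ ↦ ρ - Π₀ ρ Π₀` of the space of operators. -/
def offSupport (S : Submodule ℂ E) : (E →L[ℂ] E) →L[ℂ] (E →L[ℂ] E) :=
  1 - ContinuousLinearMap.mulLeftRight ℂ (E →L[ℂ] E) S.starProjection S.starProjection

theorem offSupport_apply (S : Submodule ℂ E) (ρ : E →L[ℂ] E) :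
    offSupport S ρ = ρ - S.starProjection * ρ * S.starProjection := by
  simp [offSupport]

theorem dist₀_eq (S : Submodule ℂ E) (ρ : E →L[ℂ] E) : dist₀ S ρ = ‖offSupport S ρ‖ := by
  rw [offSupport_apply, dist₀]

theorem sub_offSupport (S : Submodule ℂ E) (ρ : E →L[ℂ] E) :
    ρ - offSupport S ρ = S.starProjection * ρ * S.starProjection := by
  rw [offSupport_apply, sub_sub_cancel]

theorem offSupport_offSupport (S : Submodule ℂ E) (ρ : E →L[ℂ] E) :
    offSupport S (offSupport S ρ) = offSupport S ρ := by
  have h := starProjection_mul_self S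
  simp only [offSupport_apply]
  generalize S.starProjection = p at h
  have h2 : p * (p * ρ * p) * p = p * ρ * p := by
    rw [mul_assoc p ρ p, ← mul_assoc p p, h, mul_assoc, mul_assoc ρ, h]
  rw [mul_sub, sub_mul, h2, sub_self, sub_zero]

theorem traceCLM_starProjection_mul_offSupport (S : Submodule ℂ E) (ρ : E →L[ℂ] E) :
    traceCLM E ((1 - S.starProjection) * offSupport S ρ) =
      traceCLM E ((1 - S.starProjection) * ρ) := by
  have h := starProjection_mul_self S
  rw [offSupport_apply]
  generalize S.starProjection = p at h
  rw [mul_sub, sub_eq_self.2]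
  rw [← mul_assoc, ← mul_assoc, sub_mul, h, one_mul, sub_self, zero_mul, zero_mul]

/-- With `q = 1 - p`, `ρ - p ρ p = ρ q + (p ρ q)*`, so its norm is at most `2 ‖ρ q‖`; then
`norm_mul_sq_le` applies. This turns decay of the scalar leakage into decay of the distance. -/
theorem norm_offSupport_sq_le (S : Submodule ℂ E) {ρ : E →L[ℂ] E} (hρ : ρ.IsPositive) :
    ‖offSupport S ρ‖ ^ 2 ≤
      4 * ((traceCLM E ρ).re * (traceCLM E ((1 - S.starProjection) * ρ)).re) := by
  have hp := star_starProjection S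
  have hpp := starProjection_mul_self S
  have hn : ‖S.starProjection‖ ≤ 1 := S.starProjection_norm_le
  rw [offSupport_apply]
  generalize S.starProjection = p at *
  have hq : star (1 - p) = 1 - p := by rw [star_sub, star_one, hp]
  have hqq : (1 - p) * (1 - p) = 1 - p := by
    rw [mul_sub, sub_mul, sub_mul, hpp]; simp
  have hρs : star ρ = ρ := hρ.isSelfAdjoint
  have h1 : ρ - p * ρ * p = ρ * (1 - p) + star (p * (ρ * (1 - p)) ) := by
    simp only [star_mul, hq, hp, hρs]
    noncomm_ring
  have h2 : ‖ρ - p * ρ * p‖ ≤ 2 * ‖ρ * (1 - p)‖ := by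
    rw [h1]
    refine (norm_add_le _ _).trans ?_
    rw [norm_star]
    have : ‖p * (ρ * (1 - p))‖ ≤ ‖p‖ * ‖ρ * (1 - p)‖ := norm_mul_le _ _
    nlinarith [norm_nonneg (ρ * (1 - p))]
  have h3 := norm_mul_sq_le hρ (1 - p)
  have h4 : (star (1 - p) * ρ * (1 - p)).IsPositive := by
    have := isPositive_mul_mul_star hρ (1 - p)
    rwa [hq] at this ⊢
  have h5 : traceCLM E (star (1 - p) * ρ * (1 - p)) = traceCLM E ((1 - p) * ρ) := by
    rw [traceCLM_mul_comm, ← mul_assoc, hq, hqq]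
  have h6 := norm_le_re_traceCLM h4
  rw [h5] at h6
  have h7 := norm_le_re_traceCLM hρ
  calc ‖ρ - p * ρ * p‖ ^ 2 ≤ (2 * ‖ρ * (1 - p)‖) ^ 2 := by gcongr
    _ = 4 * ‖ρ * (1 - p)‖ ^ 2 := by ring
    _ ≤ 4 * (‖ρ‖ * ‖star (1 - p) * ρ * (1 - p)‖) := by gcongr
    _ ≤ _ := by gcongr; exact (norm_nonneg _).trans h7

theorem traceCLM_one_sub_starProjection_mul_nonneg (S : Submodule ℂ E) {ρ : E →L[ℂ] E}
    (hρ : ρ.IsPositive) : 0 ≤ traceCLM E ((1 - S.starProjection) * ρ) := by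
  have hp := star_starProjection S
  have hpp := starProjection_mul_self S
  generalize S.starProjection = p at *
  have hq : star (1 - p) = 1 - p := by rw [star_sub, star_one, hp]
  have hqq : (1 - p) * (1 - p) = 1 - p := by
    rw [mul_sub, sub_mul, sub_mul, hpp]; simp
  have := traceCLM_nonneg (isPositive_mul_mul_star hρ (1 - p))
  rwa [hq, traceCLM_mul_comm, ← mul_assoc, hqq] at this

theorem offSupport_eq_zero_of_mem_supportedIn {S : Submodule ℂ E} {ρ : E →L[ℂ] E}
    (hρ : ρ ∈ supportedIn S) : offSupport S ρ = 0 := by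
  obtain ⟨⟨hpos, h1⟩, h2⟩ := hρ
  have h := norm_offSupport_sq_le S hpos
  have h3 : traceCLM E ((1 - S.starProjection) * ρ) = 0 := by
    rw [sub_mul, one_mul, map_sub, traceCLM_apply, traceCLM_apply, h1, h2, sub_self]
  rw [h3, Complex.zero_re, mul_zero, mul_zero] at h
  simpa using le_antisymm h (sq_nonneg _)

-- Positive elements span a C*-algebra, and a nonzero positive operator can be normalised by its
-- trace.
variable (E) in
theorem span_densityOperators : Submodule.span ℂ (densityOperators E) = ⊤ := by
  rw [← top_le_iff, ← CStarAlgebra.span_nonneg]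
  refine Submodule.span_le.2 fun ρ hρ => ?_
  replace hρ := (ContinuousLinearMap.nonneg_iff_isPositive ρ).1 hρ
  by_cases ht : traceCLM E ρ = 0
  · rw [eq_zero_of_traceCLM_eq_zero hρ ht]
    exact Submodule.zero_mem _
  · have h1 : (traceCLM E ρ)⁻¹ • ρ ∈ densityOperators E := by
      refine ⟨hρ.smul_of_nonneg (inv_nonneg.2 (traceCLM_nonneg hρ)), ?_⟩
      rw [← traceCLM_apply, map_smul, smul_eq_mul, inv_mul_cancel₀ ht]
    rw [← smul_inv_smul₀ ht ρ]
    exact Submodule.smul_mem _ _ (Submodule.subset_span h1)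

theorem smul_compression_mem_supportedIn (S : Submodule ℂ E) {ρ : E →L[ℂ] E} (hρ : ρ.IsPositive)
    (ht : traceCLM E (S.starProjection * ρ * S.starProjection) ≠ 0) :
    (traceCLM E (S.starProjection * ρ * S.starProjection))⁻¹ •
      (S.starProjection * ρ * S.starProjection) ∈ supportedIn S := by
  have hp := star_starProjection S
  have hpp := starProjection_mul_self S
  have hpos := isPositive_mul_mul_star hρ S.starProjection
  rw [hp] at hpos
  refine ⟨⟨hpos.smul_of_nonneg (inv_nonneg.2 (traceCLM_nonneg hpos)), ?_⟩, ?_⟩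
  · rw [← traceCLM_apply, map_smul, smul_eq_mul, inv_mul_cancel₀ ht]
  · rw [← traceCLM_apply, mul_smul_comm, ← mul_assoc, ← mul_assoc, hpp, map_smul, smul_eq_mul,
      inv_mul_cancel₀ ht]

/-- A linear map that vanishes on the states supported in `S` vanishes on `Π₀ B(E) Π₀`. -/
theorem map_compression_eq_zero {F : Type*} [AddCommGroup F] [Module ℂ F] {S : Submodule ℂ E}
    (f : (E →L[ℂ] E) →ₗ[ℂ] F) (h : ∀ ρ ∈ supportedIn S, f ρ = 0) (ρ : E →L[ℂ] E) :
    f (S.starProjection * ρ * S.starProjection) = 0 := by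
  have hp := star_starProjection S
  have key := LinearMap.ext_on (span_densityOperators E) (g := 0) (f := f ∘ₗ
    (ContinuousLinearMap.mulLeftRight ℂ (E →L[ℂ] E) S.starProjection S.starProjection :
      (E →L[ℂ] E) →ₗ[ℂ] (E →L[ℂ] E))) ?_
  · simpa using LinearMap.congr_fun key ρ
  · intro σ hσ
    simp only [LinearMap.comp_apply, ContinuousLinearMap.coe_coe,
      ContinuousLinearMap.mulLeftRight_apply, LinearMap.zero_apply]
    by_cases ht : traceCLM E (S.starProjection * σ * S.starProjection) = 0
    · have hpos := isPositive_mul_mul_star hσ.1 S.starProjection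
      rw [hp] at hpos
      rw [eq_zero_of_traceCLM_eq_zero hpos ht, map_zero]
    · have h2 := h _ (smul_compression_mem_supportedIn S hσ.1 ht)
      rw [map_smul] at h2
      exact (smul_eq_zero.1 h2).resolve_left (inv_ne_zero ht)

end QuantumGAS

end

namespace QuantumGAS

/-! ### Zero sets of analytic functions; analyticity of the generator -/

open MeasureTheory in
theorem ae_ne_zero_of_analyticOnNhd_real {f : ℝ → ℂ} (hf : AnalyticOnNhd ℝ f Set.univ) {t₀ : ℝ}
    (h₀ : f t₀ ≠ 0) : ∀ᵐ t, f t ≠ 0 := by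
  have h := AnalyticOnNhd.preimage_zero_mem_codiscrete hf h₀
  have h1 := ae_restrict_le_codiscreteWithin (μ := (volume : Measure ℝ)) MeasurableSet.univ h
  rwa [Measure.restrict_univ] at h1

open MeasureTheory in
/-- The zero set of an analytic function on `ℝⁿ` that is not identically zero is a null set. -/
theorem ae_ne_zero_of_analyticAt {n : ℕ} {f : (Fin n → ℝ) → ℂ}
    (hf : ∀ x, AnalyticAt ℝ f x) {x₀ : Fin n → ℝ} (h₀ : f x₀ ≠ 0) : ∀ᵐ x, f x ≠ 0 := by
  induction n with
  | zero => exact Filter.Eventually.of_forall fun x => by rwa [Subsingleton.elim x x₀]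
  | succ n ih =>
    have hc : Continuous f := continuous_iff_continuousAt.2 fun x => (hf x).continuousAt
    have hmp := volume_preserving_piFinSuccAbove (fun _ : Fin (n + 1) => ℝ) 0
    have key : ∀ᵐ z : ℝ × (Fin n → ℝ), f (Fin.cons z.1 z.2) ≠ 0 := by
      have hcons : Continuous fun z : ℝ × (Fin n → ℝ) => (Fin.cons z.1 z.2 : Fin (n + 1) → ℝ) := by
        fun_prop
      have hm : MeasurableSet {z : ℝ × (Fin n → ℝ) | f (Fin.cons z.1 z.2) ≠ 0} :=
        (isOpen_ne.preimage (hc.comp hcons)).measurableSet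
      refine (Measure.ae_prod_mem_iff_ae_ae_mem hm).2 ?_
      -- On the line through `x₀` in the first coordinate, almost every `t` leaves a slice that is
      -- nonzero at `Fin.tail x₀`: the base point for the induction.
      have h1 : ∀ᵐ t : ℝ, f (Fin.cons t (Fin.tail x₀)) ≠ 0 := by
        refine ae_ne_zero_of_analyticOnNhd_real (t₀ := x₀ 0) (fun t _ => ?_) ?_
        · refine (hf _).fun_comp ?_
          refine analyticAt_pi_iff.2 fun i => ?_
          refine Fin.cases ?_ (fun j => ?_) i <;> simp <;> fun_prop
        · rwa [Fin.cons_self_tail]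
      filter_upwards [h1] with t ht
      refine ih (f := fun y => f (Fin.cons t y)) (fun y => ?_) ht
      refine (hf _).fun_comp ?_
      refine analyticAt_pi_iff.2 fun i => ?_
      refine Fin.cases ?_ (fun j => ?_) i
      · simpa using analyticAt_const
      · simp only [Fin.cons_succ]
        exact (ContinuousLinearMap.proj (R := ℝ) (φ := fun _ : Fin n => ℝ) j).analyticAt y
    filter_upwards [hmp.quasiMeasurePreserving.ae key] with x hx
    have hx' : (Fin.cons (x 0) (fun i => x i.succ) : Fin (n + 1) → ℝ) = x := Fin.cons_self_tail x
    simpa [MeasurableEquiv.piFinSuccAbove, Fin.insertNthEquiv, Fin.removeNth, hx'] using hx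

/-- Leibniz formula in a fixed basis: only matrix entries enter, so analyticity on each vector
suffices. -/
theorem analyticAt_linearMap_det {n : ℕ} {V : Type*} [NormedAddCommGroup V] [NormedSpace ℂ V]
    [FiniteDimensional ℂ V] {f : (Fin n → ℝ) → V →L[ℂ] V} {x : Fin n → ℝ}
    (hf : ∀ v, AnalyticAt ℝ (fun y => f y v) x) :
    AnalyticAt ℝ (fun y => LinearMap.det (f y : V →ₗ[ℂ] V)) x := by
  let b := Module.finBasis ℂ V
  have h : (fun y => LinearMap.det (f y : V →ₗ[ℂ] V)) =
      fun y => ∑ σ : Equiv.Perm (Fin (Module.finrank ℂ V)),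
        (((Equiv.Perm.sign σ : ℤ) : ℂ)) * ∏ i, b.coord (σ i) (f y (b i)) := by
    funext y
    rw [← LinearMap.det_toMatrix b, Matrix.det_apply']
    simp [LinearMap.toMatrix_apply]
  rw [h]
  refine Finset.analyticAt_fun_sum _ fun σ _ => analyticAt_const.mul
    (Finset.analyticAt_fun_prod _ fun i _ => ?_)
  exact ((((b.coord (σ i)).toContinuousLinearMap).restrictScalars ℝ).analyticAt _).fun_comp
    (hf (b i))

variable {E : Type*} [NormedAddCommGroup E] [InnerProductSpace ℂ E]
  [FiniteDimensional ℂ E] [CompleteSpace E]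

theorem IsPolynomialFamily.analyticAt {n : ℕ} {A : (Fin n → ℝ) → E →L[ℂ] E}
    (hA : IsPolynomialFamily A) (x : Fin n → ℝ) : AnalyticAt ℝ A x := by
  obtain ⟨s, a, h⟩ := hA
  have h' : A = fun x => ∑ α ∈ s, (∏ i, x i ^ α i) • a α := by
    funext y
    rw [h y]
    simp only [Complex.coe_smul]
  have hx (i : Fin n) : AnalyticAt ℝ (fun y : Fin n → ℝ => y i) x :=
    (ContinuousLinearMap.proj (R := ℝ) (φ := fun _ : Fin n => ℝ) i).analyticAt x
  rw [h']
  exact Finset.analyticAt_fun_sum _ fun α _ => AnalyticAt.fun_smul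
    (Finset.analyticAt_fun_prod _ fun i _ => (hx i).fun_pow _) analyticAt_const

/-- The adjoint is conjugate-linear, which is why analyticity is taken over `ℝ`. -/
theorem analyticAt_adjoint {n : ℕ} {A : (Fin n → ℝ) → E →L[ℂ] E} {x : Fin n → ℝ}
    (hA : AnalyticAt ℝ A x) : AnalyticAt ℝ (fun y => (A y).adjoint) x :=
  ((starL' ℝ : (E →L[ℂ] E) ≃L[ℝ] (E →L[ℂ] E)).toContinuousLinearMap.analyticAt _).fun_comp hA

theorem analyticAt_lindblad {n m : ℕ} {H : (Fin n → ℝ) → E →L[ℂ] E}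
    {L : Fin m → (Fin n → ℝ) → E →L[ℂ] E} {x : Fin n → ℝ} (hH : AnalyticAt ℝ H x)
    (hL : ∀ k, AnalyticAt ℝ (L k) x) (ρ : E →L[ℂ] E) :
    AnalyticAt ℝ (fun y => lindblad (H y) (fun k => L k y) ρ) x := by
  have hL' k := analyticAt_adjoint (hL k)
  unfold lindblad dissipator
  fun_prop

end QuantumGAS

noncomputable section

namespace QuantumGAS

open scoped ComplexOrder

variable {E : Type*} [NormedAddCommGroup E] [InnerProductSpace ℂ E]
  [FiniteDimensional ℂ E] [CompleteSpace E]

/-! ### The semigroup generated by a bounded operator -/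

section Flow

variable {V : Type*} [NormedAddCommGroup V] [NormedSpace ℂ V]

/-- The semigroup `exp (t Λ)`. -/
def flow (Λ : V →L[ℂ] V) (t : ℝ) : V →L[ℂ] V := NormedSpace.exp ((t : ℂ) • Λ)

theorem flow_zero (Λ : V →L[ℂ] V) : flow Λ 0 = 1 := by
  rw [flow, Complex.ofReal_zero, zero_smul, NormedSpace.exp_zero]

/-- A complex-linear image of a differentiable curve. -/
theorem hasDerivAt_map {W : Type*} [NormedAddCommGroup W] [NormedSpace ℂ W] (φ : V →L[ℂ] W)
    {γ : ℝ → V} {v : V} {t : ℝ} (h : HasDerivAt γ v t) :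
    HasDerivAt (fun s => φ (γ s)) (φ v) t :=
  ((φ.restrictScalars ℝ).hasFDerivAt).comp_hasDerivAt t h

variable [CompleteSpace V]

theorem hasDerivAt_flow_apply (Λ : V →L[ℂ] V) (v : V) (t : ℝ) :
    HasDerivAt (fun s => flow Λ s v) (Λ (flow Λ t v)) t :=
  hasDerivAt_map (ContinuousLinearMap.apply ℂ V v) <|
    (hasDerivAt_exp_smul_const' Λ (t : ℂ)).scomp t Complex.ofRealCLM.hasDerivAt |>.congr_deriv
      (one_smul _ _)

theorem hasDerivAt_flow_apply' (Λ : V →L[ℂ] V) (v : V) (t : ℝ) :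
    HasDerivAt (fun s => flow Λ s v) (flow Λ t (Λ v)) t :=
  hasDerivAt_map (ContinuousLinearMap.apply ℂ V v) <|
    (hasDerivAt_exp_smul_const Λ (t : ℂ)).scomp t Complex.ofRealCLM.hasDerivAt |>.congr_deriv
      (one_smul _ _)

theorem continuous_flow_of_continuous {X : Type*} [TopologicalSpace X] {Λ : X → V →L[ℂ] V}
    (hΛ : Continuous Λ) (t : ℝ) : Continuous fun x => flow (Λ x) t := by
  let _ : NormedAlgebra ℚ (V →L[ℂ] V) := NormedAlgebra.restrictScalars ℚ ℂ _
  exact NormedSpace.exp_continuous.comp (hΛ.const_smul (t : ℂ))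

theorem flow_add_smul_one (Λ : V →L[ℂ] V) (c t : ℝ) :
    flow (Λ + (c : ℂ) • 1) t = (Real.exp (t * c) : ℂ) • flow Λ t := by
  let _ : NormedAlgebra ℚ (V →L[ℂ] V) := NormedAlgebra.restrictScalars ℚ ℂ _
  have h : (t : ℂ) • (Λ + (c : ℂ) • 1) = (t : ℂ) • Λ + algebraMap ℂ (V →L[ℂ] V) (t * c) := by
    rw [Algebra.algebraMap_eq_smul_one, smul_add, smul_smul]
  rw [flow, h, NormedSpace.exp_add_of_commute (Algebra.commutes _ _).symm,
    ← NormedSpace.algebraMap_exp_comm, ← Algebra.commutes, Algebra.algebraMap_eq_smul_one,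
    smul_mul_assoc, one_mul, ← Complex.exp_eq_exp_ℂ, flow]
  push_cast
  rfl

/-- The semigroup generated by a map preserving a closed convex cone preserves that cone. -/
theorem flow_mem_of_mapsTo {Λ : V →L[ℂ] V} {C : Set V} (hC : IsClosed C) (h0 : 0 ∈ C)
    (hadd : ∀ v ∈ C, ∀ w ∈ C, v + w ∈ C) (hsmul : ∀ r : ℝ, 0 ≤ r → ∀ v ∈ C, (r : ℂ) • v ∈ C)
    (hΛ : Set.MapsTo Λ C C) {t : ℝ} (ht : 0 ≤ t) {v : V} (hv : v ∈ C) : flow Λ t v ∈ C := by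
  have h := NormedSpace.exp_series_hasSum_exp' (𝕂 := ℂ) ((t : ℂ) • Λ)
  have h' := ((ContinuousLinearMap.apply ℂ V v).hasSum h).tendsto_sum_nat
  have hpow : ∀ n : ℕ, (Λ ^ n) v ∈ C := fun n => by
    induction n with
    | zero => simpa using hv
    | succ n ih => rw [pow_succ']; exact hΛ ih
  -- The partial sums of the exponential series have coefficients `t ^ n / n! ≥ 0`, so they stay in
  -- the cone.
  refine hC.mem_of_tendsto h' (Filter.Eventually.of_forall fun N => ?_)
  refine Finset.sum_induction _ (· ∈ C) (fun a b ha hb => hadd a ha b hb) h0 fun n _ => ?_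
  have h1 : ContinuousLinearMap.apply ℂ V v (((n.factorial : ℂ)⁻¹) • ((t : ℂ) • Λ) ^ n) =
      (((n.factorial : ℝ)⁻¹ * t ^ n : ℝ) : ℂ) • ((Λ ^ n) v) := by
    rw [smul_pow, smul_smul, Complex.ofReal_mul, Complex.ofReal_inv, Complex.ofReal_pow,
      Complex.ofReal_natCast]
    rfl
  rw [h1]
  exact hsmul _ (by positivity) _ (hpow n)

end Flow

theorem isClosed_isPositive : IsClosed {ρ : E →L[ℂ] E | ρ.IsPositive} := by
  simp_rw [← ContinuousLinearMap.nonneg_iff_isPositive]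
  exact CStarAlgebra.isClosed_nonneg

/-- The semigroup generated by `Λ` is positive as soon as `Λ + c` is positive for some `c`. -/
theorem isPositive_flow_of_add {Λ : (E →L[ℂ] E) →L[ℂ] (E →L[ℂ] E)} {c : ℝ}
    (hΛ : ∀ ρ : E →L[ℂ] E, ρ.IsPositive → (Λ ρ + (c : ℂ) • ρ).IsPositive) {t : ℝ} (ht : 0 ≤ t)
    {ρ : E →L[ℂ] E} (hρ : ρ.IsPositive) : (flow Λ t ρ).IsPositive := by
  have h1 : (flow (Λ + (c : ℂ) • 1) t ρ).IsPositive :=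
    flow_mem_of_mapsTo (C := {ρ : E →L[ℂ] E | ρ.IsPositive}) isClosed_isPositive
      ContinuousLinearMap.isPositive_zero (fun _ hv _ hw => hv.add hw)
      (fun r hr v hv => hv.smul_of_nonneg (by exact_mod_cast hr)) (fun σ hσ => hΛ σ hσ) ht hρ
  have h2 : flow Λ t ρ = ((Real.exp (t * c))⁻¹ : ℝ) • flow (Λ + (c : ℂ) • 1) t ρ := by
    rw [flow_add_smul_one, smul_apply, Complex.coe_smul,
      inv_smul_smul₀ (Real.exp_pos _).ne']
  rw [h2, ← Complex.coe_smul]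
  exact h1.smul_of_nonneg (by exact_mod_cast (inv_pos.2 (Real.exp_pos _)).le)

/-! ### The Lindblad semigroup -/

/-- The Lindblad generator as a continuous linear map. -/
def lindbladCLM {m : ℕ} (H : E →L[ℂ] E) (L : Fin m → E →L[ℂ] E) :
    (E →L[ℂ] E) →L[ℂ] (E →L[ℂ] E) :=
  LinearMap.toContinuousLinearMap
    { toFun := lindblad H L
      map_add' := fun ρ σ => by
        simp only [lindblad, dissipator, mul_add, add_mul, smul_add, smul_sub,
          Finset.sum_sub_distrib, Finset.sum_add_distrib]
        abel
      map_smul' := fun c ρ => by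
        simp only [lindblad, dissipator, mul_smul_comm, smul_mul_assoc, smul_add, smul_sub,
          RingHom.id_apply, Finset.smul_sum, smul_comm c] }

theorem lindbladCLM_apply {m : ℕ} (H : E →L[ℂ] E) (L : Fin m → E →L[ℂ] E) (ρ : E →L[ℂ] E) :
    lindbladCLM H L ρ = lindblad H L ρ := rfl

theorem isTrajectory_flow {m : ℕ} (H : E →L[ℂ] E) (L : Fin m → E →L[ℂ] E) (ρ : E →L[ℂ] E) :
    IsTrajectory H L fun t => flow (lindbladCLM H L) t ρ := fun t _ =>
  (hasDerivAt_flow_apply (lindbladCLM H L) ρ t).hasDerivWithinAt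

/-- Uniqueness for a Lipschitz vector field; it reduces claims about all trajectories to the
semigroup. -/
theorem IsTrajectory.eq_flow {m : ℕ} {H : E →L[ℂ] E} {L : Fin m → E →L[ℂ] E}
    {ρ : ℝ → E →L[ℂ] E} (h : IsTrajectory H L ρ) {t : ℝ} (ht : 0 ≤ t) :
    ρ t = flow (lindbladCLM H L) t (ρ 0) := by
  have h2 := isTrajectory_flow H L (ρ 0)
  have key : Set.EqOn ρ (fun t => flow (lindbladCLM H L) t (ρ 0)) (Set.Icc 0 t) := by
    refine ODE_solution_unique_of_mem_Icc_right (v := fun _ => lindbladCLM H L)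
      (s := fun _ => Set.univ) (K := ‖lindbladCLM H L‖₊)
      (fun _ _ => (lindbladCLM H L).lipschitz.lipschitzOnWith) ?_ ?_ ?_ ?_ ?_ ?_ ?_
    · exact fun s hs => ((h s hs.1).continuousWithinAt).mono Set.Icc_subset_Ici_self
    · exact fun s hs => (h s hs.1).mono (Set.Ici_subset_Ici.2 hs.1)
    · exact fun _ _ => trivial
    · exact fun s hs => ((h2 s hs.1).continuousWithinAt).mono Set.Icc_subset_Ici_self
    · exact fun s hs => (h2 s hs.1).mono (Set.Ici_subset_Ici.2 hs.1)
    · exact fun _ _ => trivial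
    · simp [flow_zero]
  exact key ⟨ht, le_rfl⟩

theorem traceCLM_lindblad {m : ℕ} (H : E →L[ℂ] E) (L : Fin m → E →L[ℂ] E) (ρ : E →L[ℂ] E) :
    traceCLM E (lindblad H L ρ) = 0 := by
  have h1 : ∀ k, traceCLM E (dissipator (L k) ρ) = 0 := fun k => by
    rw [dissipator, map_sub, map_sub, map_smul, map_smul, traceCLM_mul_comm ρ,
      traceCLM_mul_comm (L k * ρ), ← mul_assoc]
    simp only [smul_eq_mul]
    ring
  rw [lindblad, map_add, map_smul, map_sub, traceCLM_mul_comm H, sub_self, smul_zero, map_sum,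
    zero_add]
  exact Finset.sum_eq_zero fun k _ => h1 k

theorem traceCLM_flow {m : ℕ} (H : E →L[ℂ] E) (L : Fin m → E →L[ℂ] E) (ρ : E →L[ℂ] E) (t : ℝ) :
    traceCLM E (flow (lindbladCLM H L) t ρ) = traceCLM E ρ := by
  have h : ∀ s : ℝ, HasDerivAt (fun s => traceCLM E (flow (lindbladCLM H L) s ρ)) 0 s := fun s => by
    have := hasDerivAt_map (traceCLM E) (hasDerivAt_flow_apply (lindbladCLM H L) ρ s)
    rwa [lindbladCLM_apply, traceCLM_lindblad] at this
  have := is_const_of_deriv_eq_zero (fun s => (h s).differentiableAt) (fun s => (h s).deriv) t 0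
  simpa [flow_zero] using this

/-- The non-Hermitian part `-i H - (1/2) ∑ₖ Lₖ* Lₖ` of the generator. -/
def drift {m : ℕ} (H : E →L[ℂ] E) (L : Fin m → E →L[ℂ] E) : E →L[ℂ] E :=
  -Complex.I • H - (1 / 2 : ℂ) • ∑ k, (L k).adjoint * L k

theorem lindblad_eq_drift {m : ℕ} {H : E →L[ℂ] E} (hH : IsSelfAdjoint H) (L : Fin m → E →L[ℂ] E)
    (ρ : E →L[ℂ] E) :
    lindblad H L ρ = drift H L * ρ + ρ * star (drift H L) + ∑ k, L k * ρ * star (L k) := by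
  have hH' : star H = H := hH
  rw [lindblad, smul_sub]
  simp only [dissipator, drift, ← ContinuousLinearMap.star_eq_adjoint, star_sub,
    star_smul, star_sum, star_mul, star_star, hH', sub_mul, mul_sub, smul_mul_assoc,
    mul_smul_comm, Finset.sum_mul, Finset.mul_sum, Finset.sum_sub_distrib, Finset.smul_sum,
    star_neg, neg_mul, Complex.star_def, Complex.conj_I, neg_neg, neg_smul, map_div₀, map_one,
    map_ofNat]
  abel

/-- The Lindblad generator plus `ε G ρ G*`: up to a multiple of `ρ`, a completely positive map. -/
def regularizedLindblad {m : ℕ} (H : E →L[ℂ] E) (L : Fin m → E →L[ℂ] E) (ε : ℝ) :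
    (E →L[ℂ] E) →L[ℂ] (E →L[ℂ] E) :=
  lindbladCLM H L +
    (ε : ℂ) • ContinuousLinearMap.mulLeftRight ℂ (E →L[ℂ] E) (drift H L) (star (drift H L))

/-- Completing the square: `ε (ε⁻¹ + G) ρ (ε⁻¹ + G)* = ε⁻¹ ρ + G ρ + ρ G* + ε G ρ G*`. -/
theorem isPositive_regularizedLindblad_add {m : ℕ} {H : E →L[ℂ] E} (hH : IsSelfAdjoint H)
    (L : Fin m → E →L[ℂ] E) {ε : ℝ} (hε : 0 < ε) {ρ : E →L[ℂ] E} (hρ : ρ.IsPositive) :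
    (regularizedLindblad H L ε ρ + ((ε⁻¹ : ℝ) : ℂ) • ρ).IsPositive := by
  set G := drift H L with hG
  have hε' : (ε : ℂ) ≠ 0 := by exact_mod_cast hε.ne'
  have h1 : regularizedLindblad H L ε ρ + ((ε⁻¹ : ℝ) : ℂ) • ρ =
      (ε : ℂ) • ((((ε⁻¹ : ℝ) : ℂ) • 1 + G) * ρ * star ((((ε⁻¹ : ℝ) : ℂ) • 1 + G))) +
        ∑ k, L k * ρ * star (L k) := by
    simp only [regularizedLindblad, add_apply, smul_apply,
      ContinuousLinearMap.mulLeftRight_apply, lindbladCLM_apply, lindblad_eq_drift hH, ← hG,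
      star_add, star_smul, star_one, Complex.star_def, Complex.conj_ofReal, add_mul, mul_add,
      smul_mul_assoc, mul_smul_comm, one_mul, mul_one, smul_add, smul_smul]
    push_cast
    rw [mul_inv_cancel₀ hε', mul_inv_cancel_left₀ hε', one_smul, one_smul]
    abel
  rw [h1]
  refine ((isPositive_mul_mul_star hρ _).smul_of_nonneg (by exact_mod_cast hε.le)).add
    (ContinuousLinearMap.isPositive_sum _ fun k _ => isPositive_mul_mul_star hρ _)

/-- The regularized semigroups are positive; let `ε → 0+`, the positive cone being closed. -/
theorem isPositive_flow {m : ℕ} {H : E →L[ℂ] E} (hH : IsSelfAdjoint H) (L : Fin m → E →L[ℂ] E)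
    {t : ℝ} (ht : 0 ≤ t) {ρ : E →L[ℂ] E} (hρ : ρ.IsPositive) :
    (flow (lindbladCLM H L) t ρ).IsPositive := by
  have h1 : Continuous fun ε : ℝ => regularizedLindblad H L ε := by
    unfold regularizedLindblad
    fun_prop
  have hc : Continuous fun ε : ℝ => flow (regularizedLindblad H L ε) t ρ :=
    (continuous_flow_of_continuous h1 t).clm_apply continuous_const
  have h0 : regularizedLindblad H L 0 = lindbladCLM H L := by
    simp [regularizedLindblad]
  have h3 : Filter.Tendsto (fun ε : ℝ => flow (regularizedLindblad H L ε) t ρ)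
      (nhdsWithin 0 (Set.Ioi 0)) (nhds (flow (lindbladCLM H L) t ρ)) := by
    rw [← h0]
    exact (hc.tendsto 0).mono_left nhdsWithin_le_nhds
  refine isClosed_isPositive.mem_of_tendsto h3 ?_
  filter_upwards [self_mem_nhdsWithin] with ε hε
  exact isPositive_flow_of_add (fun σ hσ => isPositive_regularizedLindblad_add hH L hε hσ) ht hρ

theorem flow_mem_densityOperators {m : ℕ} {H : E →L[ℂ] E} (hH : IsSelfAdjoint H)
    (L : Fin m → E →L[ℂ] E) {t : ℝ} (ht : 0 ≤ t) {ρ : E →L[ℂ] E} (hρ : ρ ∈ densityOperators E) :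
    flow (lindbladCLM H L) t ρ ∈ densityOperators E :=
  ⟨isPositive_flow hH L ht hρ.1, (traceCLM_flow H L ρ t).trans hρ.2⟩

end QuantumGAS

end

noncomputable section

namespace QuantumGAS

open Filter Topology

variable {E : Type*} [NormedAddCommGroup E] [InnerProductSpace ℂ E]
  [FiniteDimensional ℂ E] [CompleteSpace E]

/-! ### Convergence of integrable nonnegative functions -/

/-- A nonnegative Lipschitz function with a bounded primitive tends to zero at infinity. -/
theorem tendsto_zero_of_bounded_primitive {F f g : ℝ → ℝ} {C K : ℝ}
    (hF : ∀ t, HasDerivAt F (f t) t) (hf : ∀ t, HasDerivAt f (g t) t)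
    (hf0 : ∀ t, 0 ≤ t → 0 ≤ f t) (hFC : ∀ t, 0 ≤ t → F t ≤ C) (hgK : ∀ t, 0 ≤ t → |g t| ≤ K) :
    Tendsto f atTop (𝓝 0) := by
  have hK : 0 ≤ K := (abs_nonneg _).trans (hgK 0 le_rfl)
  have hmono : MonotoneOn F (Set.Ici 0) := by
    refine monotoneOn_of_deriv_nonneg (convex_Ici 0)
      (fun t _ => (hF t).continuousAt.continuousWithinAt)
      (fun t _ => (hF t).differentiableAt.differentiableWithinAt) fun t ht => ?_
    rw [interior_Ici] at ht
    rw [(hF t).deriv]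
    exact hf0 t (le_of_lt ht)
  obtain ⟨l, hl⟩ : ∃ l, Tendsto F atTop (𝓝 l) := by
    -- Freezing `F` at `F 0` for negative times makes it monotone on all of `ℝ`.
    have hm : Monotone fun t => F (max t 0) := fun a b hab =>
      hmono (Set.mem_Ici.2 (le_max_right _ _)) (Set.mem_Ici.2 (le_max_right _ _))
        (max_le_max_right 0 hab)
    have hb : BddAbove (Set.range fun t => F (max t 0)) :=
      ⟨C, by rintro _ ⟨t, rfl⟩; exact hFC _ (le_max_right _ _)⟩
    refine ⟨_, (tendsto_atTop_ciSup hm hb).congr' ?_⟩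
    filter_upwards [eventually_ge_atTop 0] with t ht
    rw [max_eq_left ht]
  -- The mean of `f` over `[t, t + s]` is attained at some `u`, and `f t` exceeds `f u` by at most
  -- `K * s`.
  have hbound : ∀ s : ℝ, 0 < s → ∀ t : ℝ, 0 ≤ t → f t ≤ (F (t + s) - F t) / s + K * s := by
    intro s hs t ht
    obtain ⟨u, hu, hu'⟩ := exists_hasDerivAt_eq_slope F f (lt_add_of_pos_right t hs)
      (fun u _ => (hF u).continuousAt.continuousWithinAt) fun u _ => hF u
    obtain ⟨v, hv, hv'⟩ := exists_hasDerivAt_eq_slope f g hu.1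
      (fun u _ => (hf u).continuousAt.continuousWithinAt) fun u _ => hf u
    rw [add_sub_cancel_left] at hu'
    rw [← hu']
    have hut : 0 < u - t := sub_pos.2 hu.1
    have h1 : f u - f t = g v * (u - t) := by rw [hv']; field_simp
    have h2 := (abs_le.1 (hgK v (ht.trans hv.1.le))).1
    have h3 : u - t ≤ s := by linarith [hu.2]
    nlinarith
  rw [Metric.tendsto_atTop']
  intro ε hε
  set s := ε / (2 * (K + 1)) with hs
  have hs0 : 0 < s := by positivity
  have hKs : K * s ≤ ε / 2 := by
    rw [hs, mul_div_assoc', div_le_div_iff₀ (by positivity) (by positivity)]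
    nlinarith
  have hlim : Tendsto (fun t => (F (t + s) - F t) / s) atTop (𝓝 0) := by
    have := ((hl.comp (tendsto_atTop_add_const_right atTop s tendsto_id)).sub hl).div_const s
    simpa using this
  have hev := (hlim.eventually (gt_mem_nhds (half_pos hε))).and (eventually_ge_atTop 0)
  obtain ⟨N, hN⟩ := eventually_atTop.1 hev
  refine ⟨N, fun t ht => ?_⟩
  obtain ⟨h1, h2⟩ := hN t ht.le
  rw [Real.dist_eq, sub_zero, abs_of_nonneg (hf0 t h2)]
  linarith [hbound s hs0 t h2]

/-! ### Asymptotic stability and invertibility of the compressed generator -/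

theorem norm_le_one_of_mem_densityOperators {ρ : E →L[ℂ] E} (hρ : ρ ∈ densityOperators E) :
    ‖ρ‖ ≤ 1 := by
  have := norm_le_re_traceCLM hρ.1
  rwa [traceCLM_apply, hρ.2, Complex.one_re] at this

/-- Orbits of states have norm at most one and states span, so every orbit is bounded; uniform
boundedness does the rest. -/
theorem exists_norm_flow_le {m : ℕ} {H : E →L[ℂ] E} (hH : IsSelfAdjoint H)
    (L : Fin m → E →L[ℂ] E) : ∃ K, ∀ t : ℝ, 0 ≤ t → ‖flow (lindbladCLM H L) t‖ ≤ K := by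
  have hb : ∀ ρ, ∃ C, ∀ t : Set.Ici (0 : ℝ), ‖flow (lindbladCLM H L) t ρ‖ ≤ C := by
    intro ρ
    have hρ : ρ ∈ Submodule.span ℂ (densityOperators E) := by
      rw [span_densityOperators]; trivial
    induction hρ using Submodule.span_induction with
    | mem ρ h =>
      exact ⟨1, fun t => norm_le_one_of_mem_densityOperators (flow_mem_densityOperators hH L t.2 h)⟩
    | zero => exact ⟨0, fun t => by simp⟩
    | add ρ σ _ _ hρ hσ =>
      obtain ⟨a, ha⟩ := hρ
      obtain ⟨b, hb⟩ := hσ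
      refine ⟨a + b, fun t => ?_⟩
      rw [map_add]
      exact (norm_add_le _ _).trans (add_le_add (ha t) (hb t))
    | smul c ρ _ hρ =>
      obtain ⟨a, ha⟩ := hρ
      refine ⟨‖c‖ * a, fun t => ?_⟩
      rw [map_smul, norm_smul]
      exact mul_le_mul_of_nonneg_left (ha t) (norm_nonneg _)
  obtain ⟨K, hK⟩ := banach_steinhaus hb
  exact ⟨K, fun t ht => hK ⟨t, ht⟩⟩

theorem offSupport_flow_compression {m : ℕ} {S : Submodule ℂ E} {H : E →L[ℂ] E}
    {L : Fin m → E →L[ℂ] E} (hinv : IsInvariant S H L) {t : ℝ} (ht : 0 ≤ t) (ρ : E →L[ℂ] E) :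
    offSupport S (flow (lindbladCLM H L) t (S.starProjection * ρ * S.starProjection)) = 0 := by
  refine map_compression_eq_zero
    ((offSupport S ∘L flow (lindbladCLM H L) t : (E →L[ℂ] E) →L[ℂ] (E →L[ℂ] E)) :
      (E →L[ℂ] E) →ₗ[ℂ] (E →L[ℂ] E)) (fun σ hσ => ?_) ρ
  exact offSupport_eq_zero_of_mem_supportedIn
    (hinv _ (isTrajectory_flow H L σ) (by simpa [flow_zero] using hσ) t ht)

theorem offSupport_flow {m : ℕ} {S : Submodule ℂ E} {H : E →L[ℂ] E}
    {L : Fin m → E →L[ℂ] E} (hinv : IsInvariant S H L) {t : ℝ} (ht : 0 ≤ t) (ρ : E →L[ℂ] E) :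
    offSupport S (flow (lindbladCLM H L) t ρ) =
      offSupport S (flow (lindbladCLM H L) t (offSupport S ρ)) := by
  have := offSupport_flow_compression hinv ht ρ
  rwa [← sub_offSupport, map_sub, map_sub, sub_eq_zero] at this

/-- The one-sided derivative at time zero of `offSupport_flow_compression`. -/
theorem offSupport_lindblad {m : ℕ} {S : Submodule ℂ E} {H : E →L[ℂ] E}
    {L : Fin m → E →L[ℂ] E} (hinv : IsInvariant S H L) (ρ : E →L[ℂ] E) :
    offSupport S (lindbladCLM H L ρ) = offSupport S (lindbladCLM H L (offSupport S ρ)) := by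
  set σ := S.starProjection * ρ * S.starProjection with hσ
  have h1 := (hasDerivAt_map (offSupport S)
    (hasDerivAt_flow_apply' (lindbladCLM H L) σ 0)).hasDerivWithinAt (s := Set.Ici 0)
  have h2 : HasDerivWithinAt (fun s => offSupport S (flow (lindbladCLM H L) s σ)) 0
      (Set.Ici 0) 0 :=
    (hasDerivWithinAt_const (0 : ℝ) (Set.Ici 0) (0 : E →L[ℂ] E)).congr
      (fun s hs => offSupport_flow_compression hinv hs ρ)
      (offSupport_flow_compression hinv le_rfl ρ)
  have h3 := (uniqueDiffWithinAt_Ici (0 : ℝ)).eq_deriv _ h1 h2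
  rw [flow_zero, one_apply_eq_self, hσ, ← sub_offSupport, map_sub, map_sub,
    sub_eq_zero] at h3
  exact h3

/-- The generator induced on the complement of `Π₀ B(E) Π₀`, extended by the identity. -/
def compressedGenerator {m : ℕ} (S : Submodule ℂ E) (H : E →L[ℂ] E) (L : Fin m → E →L[ℂ] E) :
    (E →L[ℂ] E) →L[ℂ] (E →L[ℂ] E) :=
  offSupport S ∘L lindbladCLM H L ∘L offSupport S + (1 - offSupport S)

theorem compressedGenerator_apply {m : ℕ} (S : Submodule ℂ E) (H : E →L[ℂ] E)
    (L : Fin m → E →L[ℂ] E) (ρ : E →L[ℂ] E) :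
    compressedGenerator S H L ρ =
      offSupport S (lindblad H L (offSupport S ρ)) + (ρ - offSupport S ρ) := rfl

theorem compressedGenerator_offSupport {m : ℕ} {S : Submodule ℂ E} {H : E →L[ℂ] E}
    {L : Fin m → E →L[ℂ] E} (hinv : IsInvariant S H L) (ρ : E →L[ℂ] E) :
    compressedGenerator S H L (offSupport S ρ) = offSupport S (lindbladCLM H L ρ) := by
  rw [compressedGenerator_apply, offSupport_offSupport, sub_self, add_zero,
    offSupport_lindblad hinv, lindbladCLM_apply]

/-- Stability is automatic: `Q exp (t Λ) = Q exp (t Λ) Q` bounds the distance at time `t` by `‖Q‖ *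
K` times the initial one. -/
theorem isGAS_of_tendsto {m : ℕ} {S : Submodule ℂ E} {H : E →L[ℂ] E} (hH : IsSelfAdjoint H)
    {L : Fin m → E →L[ℂ] E} (hinv : IsInvariant S H L)
    (h : ∀ ρ ∈ densityOperators E,
      Tendsto (fun t => ‖offSupport S (flow (lindbladCLM H L) t ρ)‖) atTop (𝓝 0)) :
    IsGAS S H L := by
  refine ⟨hinv, fun ε hε _ => ?_, fun ρ hρ h0 => (h _ h0).congr' ?_⟩
  · obtain ⟨K, hK⟩ := exists_norm_flow_le hH L
    have hK0 : 0 ≤ K := (norm_nonneg _).trans (hK 0 le_rfl)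
    refine ⟨ε / (‖offSupport S‖ * K + 1), by positivity, fun ρ hρ _ hd t ht => ?_⟩
    rw [dist₀_eq] at hd ⊢
    rw [hρ.eq_flow ht, offSupport_flow hinv ht]
    calc _ ≤ ‖offSupport S‖ * (‖flow (lindbladCLM H L) t‖ * ‖offSupport S (ρ 0)‖) :=
          (ContinuousLinearMap.le_opNorm _ _).trans
            (by gcongr; exact ContinuousLinearMap.le_opNorm _ _)
      _ ≤ ‖offSupport S‖ * (K * (ε / (‖offSupport S‖ * K + 1))) := by
          gcongr
          exact hK t ht
      _ = ε * ((‖offSupport S‖ * K) / (‖offSupport S‖ * K + 1)) := by ring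
      _ ≤ ε * 1 := by
          gcongr
          exact div_le_one_of_le₀ (by linarith) (by positivity)
      _ = ε := mul_one ε
  · filter_upwards [eventually_ge_atTop 0] with t ht
    rw [dist₀_eq, hρ.eq_flow ht]

theorem IsGAS.tendsto_offSupport_flow {m : ℕ} {S : Submodule ℂ E} {H : E →L[ℂ] E}
    {L : Fin m → E →L[ℂ] E} (h : IsGAS S H L) (ρ : E →L[ℂ] E) :
    Tendsto (fun t => offSupport S (flow (lindbladCLM H L) t ρ)) atTop (𝓝 0) := by
  have hρ : ρ ∈ Submodule.span ℂ (densityOperators E) := by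
    rw [span_densityOperators]; trivial
  induction hρ using Submodule.span_induction with
  | mem ρ hρ =>
    have := h.2.2 _ (isTrajectory_flow H L ρ) (by simpa [flow_zero] using hρ)
    simp only [dist₀_eq] at this
    exact tendsto_zero_iff_norm_tendsto_zero.2 this
  | zero => simp
  | add ρ σ _ _ hρ hσ => simpa using hρ.add hσ
  | smul c ρ _ hρ => simpa using hρ.const_smul c

theorem IsGAS.det_compressedGenerator_ne_zero {m : ℕ} {S : Submodule ℂ E} {H : E →L[ℂ] E}
    {L : Fin m → E →L[ℂ] E} (h : IsGAS S H L) :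
    LinearMap.det (compressedGenerator S H L : (E →L[ℂ] E) →ₗ[ℂ] (E →L[ℂ] E)) ≠ 0 := by
  intro hdet
  obtain ⟨ρ, hρ, hρ0⟩ := (Submodule.ne_bot_iff _).1 (LinearMap.bot_lt_ker_of_det_eq_zero hdet).ne'
  have h1 : compressedGenerator S H L ρ = 0 := hρ
  have h2 : ρ - offSupport S ρ = 0 := by
    -- Applying `1 - Q` to `M ρ = 0` kills the block `Q Λ Q`.
    have := congrArg (fun σ => σ - offSupport S σ) h1
    rw [compressedGenerator_apply] at this
    simpa only [map_add, map_sub, map_zero, offSupport_offSupport, sub_self, sub_zero, add_zero,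
      add_sub_cancel_left] using this
  have h3 : offSupport S ρ = ρ := (sub_eq_zero.1 h2).symm
  have h4 : offSupport S (lindbladCLM H L ρ) = 0 := by
    rwa [← compressedGenerator_offSupport h.1, h3]
  have h5 : ∀ t : ℝ, 0 ≤ t → offSupport S (flow (lindbladCLM H L) t ρ) = ρ := by
    intro t ht
    have hd : ∀ s : ℝ, HasDerivAt (fun s => offSupport S (flow (lindbladCLM H L) s ρ))
        (offSupport S (flow (lindbladCLM H L) s (lindbladCLM H L ρ))) s := fun s =>
      hasDerivAt_map (offSupport S) (hasDerivAt_flow_apply' (lindbladCLM H L) ρ s)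
    have hc := constant_of_has_deriv_right_zero (a := 0) (b := t)
      (fun s _ => (hd s).continuousAt.continuousWithinAt) (fun s hs => by
        have := (hd s).hasDerivWithinAt (s := Set.Ici s)
        rwa [offSupport_flow h.1 hs.1, h4, map_zero, map_zero] at this) t ⟨ht, le_rfl⟩
    rw [hc, flow_zero, one_apply_eq_self, h3]
  have h6 : Tendsto (fun _ : ℝ => ρ) atTop (𝓝 0) := by
    refine (h.tendsto_offSupport_flow ρ).congr' ?_
    filter_upwards [eventually_ge_atTop 0] with t ht using h5 t ht
  exact hρ0 (tendsto_nhds_unique tendsto_const_nhds h6)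

theorem tendsto_traceCLM_of_det_ne_zero {m : ℕ} {S : Submodule ℂ E} {H : E →L[ℂ] E}
    (hH : IsSelfAdjoint H) {L : Fin m → E →L[ℂ] E} (hinv : IsInvariant S H L)
    (hdet : LinearMap.det (compressedGenerator S H L : (E →L[ℂ] E) →ₗ[ℂ] (E →L[ℂ] E)) ≠ 0)
    {ρ : E →L[ℂ] E} (hρ : ρ ∈ densityOperators E) :
    Tendsto (fun t => (traceCLM E ((1 - S.starProjection) *
      flow (lindbladCLM H L) t ρ)).re) atTop (𝓝 0) := by
  set Λ := lindbladCLM H L with hΛ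
  let B : (E →L[ℂ] E) →L[ℂ] (E →L[ℂ] E) := LinearMap.toContinuousLinearMap
    ((LinearMap.equivOfDetNeZero _ hdet).symm : (E →L[ℂ] E) →ₗ[ℂ] (E →L[ℂ] E))
  have hB : ∀ σ, B (compressedGenerator S H L σ) = σ := fun σ =>
    (LinearMap.equivOfDetNeZero _ hdet).symm_apply_apply σ
  let φ : (E →L[ℂ] E) →L[ℂ] ℂ :=
    traceCLM E ∘L ContinuousLinearMap.mul ℂ (E →L[ℂ] E) (1 - S.starProjection)
  have hφ : ∀ σ, φ σ = traceCLM E ((1 - S.starProjection) * σ) := fun σ => rfl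
  have hre : ∀ {γ : ℝ → ℂ} {v : ℂ} {t : ℝ}, HasDerivAt γ v t →
      HasDerivAt (fun s => (γ s).re) v.re t := fun {_ _ t} h =>
    Complex.reCLM.hasFDerivAt.comp_hasDerivAt t h
  have hbd : ∀ (ψ : (E →L[ℂ] E) →L[ℂ] ℂ) (t : ℝ), 0 ≤ t → |(ψ (flow Λ t ρ)).re| ≤ ‖ψ‖ := by
    intro ψ t ht
    refine (Complex.abs_re_le_norm _).trans (ψ.le_of_opNorm_le_of_le le_rfl
      (norm_le_one_of_mem_densityOperators (flow_mem_densityOperators hH L ht hρ)) |>.trans ?_)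
    rw [mul_one]
  refine tendsto_zero_of_bounded_primitive
    -- Since `Q Λ ρ_t = M Q ρ_t`, the inverse `B` of `M` makes the derivative of `F` equal to `Re φ
    -- (Q ρ_t)`; and `φ ∘ Q = φ` because `(1 - p) p = 0`.
    (F := fun t => (φ (B (offSupport S (flow Λ t ρ)))).re) (g := fun t => (φ (Λ (flow Λ t ρ))).re)
    (C := ‖φ ∘L B ∘L offSupport S‖) (K := ‖φ ∘L Λ‖) (fun t => ?_) (fun t => ?_) (fun t ht => ?_)
    (fun t ht => ?_) (fun t ht => hbd (φ ∘L Λ) t ht)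
  · have h := hre (hasDerivAt_map (φ ∘L B ∘L offSupport S) (hasDerivAt_flow_apply Λ ρ t))
    refine h.congr_deriv ?_
    change (φ (B (offSupport S (Λ (flow Λ t ρ))))).re = _
    rw [hΛ, ← compressedGenerator_offSupport hinv, hB, hφ, traceCLM_starProjection_mul_offSupport]
  · exact hre (hasDerivAt_map φ (hasDerivAt_flow_apply Λ ρ t))
  · have := traceCLM_one_sub_starProjection_mul_nonneg S (isPositive_flow hH L ht hρ.1)
    exact (Complex.le_def.1 this).1
  · exact (le_abs_self _).trans (hbd (φ ∘L B ∘L offSupport S) t ht)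

theorem isGAS_of_det_ne_zero {m : ℕ} {S : Submodule ℂ E} {H : E →L[ℂ] E}
    (hH : IsSelfAdjoint H) {L : Fin m → E →L[ℂ] E} (hinv : IsInvariant S H L)
    (hdet : LinearMap.det (compressedGenerator S H L : (E →L[ℂ] E) →ₗ[ℂ] (E →L[ℂ] E)) ≠ 0) :
    IsGAS S H L := by
  refine isGAS_of_tendsto hH hinv fun ρ hρ => ?_
  have h1 := ((tendsto_traceCLM_of_det_ne_zero hH hinv hdet hρ).const_mul 4).sqrt
  rw [mul_zero, Real.sqrt_zero] at h1
  refine squeeze_zero' (Eventually.of_forall fun t => norm_nonneg _) ?_ h1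
  filter_upwards [eventually_ge_atTop 0] with t ht
  refine Real.le_sqrt_of_sq_le ?_
  have h2 := norm_offSupport_sq_le S (isPositive_flow hH L ht hρ.1)
  rwa [traceCLM_flow, traceCLM_apply ρ, hρ.2, Complex.one_re, one_mul] at h2

theorem analyticAt_det_compressedGenerator {n m : ℕ} (S : Submodule ℂ E)
    {H : (Fin n → ℝ) → E →L[ℂ] E} {L : Fin m → (Fin n → ℝ) → E →L[ℂ] E}
    (hH : IsPolynomialFamily H) (hL : ∀ k, IsPolynomialFamily (L k)) (x : Fin n → ℝ) :
    AnalyticAt ℝ (fun y => LinearMap.det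
      (compressedGenerator S (H y) (fun k => L k y) : (E →L[ℂ] E) →ₗ[ℂ] (E →L[ℂ] E))) x := by
  refine analyticAt_linearMap_det fun ρ => ?_
  simp only [compressedGenerator_apply]
  exact ((((offSupport S).restrictScalars ℝ).analyticAt _).fun_comp
    (analyticAt_lindblad (hH.analyticAt x) (fun k => (hL k).analyticAt x) _)).fun_add
      analyticAt_const

end QuantumGAS

end

theorem mainTheorem2 {E : Type*} [NormedAddCommGroup E] [InnerProductSpace ℂ E]
    [FiniteDimensional ℂ E] [CompleteSpace E] (S : Submodule ℂ E) {n m : ℕ}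
    (H : (Fin n → ℝ) → E →L[ℂ] E) (L : Fin m → (Fin n → ℝ) → E →L[ℂ] E)
    (hH_selfAdjoint : ∀ x, IsSelfAdjoint (H x))
    (hH_poly : QuantumGAS.IsPolynomialFamily H)
    (hL_poly : ∀ k, QuantumGAS.IsPolynomialFamily (L k))
    (hS_inv : ∀ x, QuantumGAS.IsInvariant S (H x) (fun k => L k x))
    (hS_gas : ∃ x₀, QuantumGAS.IsGAS S (H x₀) (fun k => L k x₀)) :
    ∀ᵐ x ∂(MeasureTheory.volume : MeasureTheory.Measure (Fin n → ℝ)),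
      QuantumGAS.IsGAS S (H x) (fun k => L k x) := by
  obtain ⟨x₀, h₀⟩ := hS_gas
  filter_upwards [QuantumGAS.ae_ne_zero_of_analyticAt
    (QuantumGAS.analyticAt_det_compressedGenerator S hH_poly hL_poly)
    h₀.det_compressedGenerator_ne_zero] with x hx
  exact QuantumGAS.isGAS_of_det_ne_zero (hH_selfAdjoint x) (hS_inv x) hx
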